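/- Let $V$ be a finite set with $n\ge 0$ elements, let $2^V$ be the $(n-1)$-dimensional simplex with vertex set $V$, and let $\mathrm{sd}^{(2)}(2^V)$ be its second barycentric subdivision, where the barycentric subdivision $\mathrm{sd}(\Delta)$ of a simplicial complex $\Delta$ is the complex of all chains of nonempty faces of $\Delta$ ordered by inclusion. For a triangulation $\Gamma$ of $2^V$, the local $h$-polynomial is $\ell_V(\Gamma,x)=\sum_{F\subseteq V}(-1)^{n-|F|}\,h(\Gamma_F,x)$, where $\Gamma_F$ is the restriction of $\Gamma$ to the face $F$ of $2^V$ and $h(\Delta,x)=\sum_{i=0}^{m} f_{i-1}(\Delta)\,x^i(1-x)^{m-i}$ for an $(m-1)$-dimensional simplicial complex $\Delta$ with $f_{i-1}(\Delta)$ faces of dimension $i-1$ (and $f_{-1}(\Delta)=1$). Let $\mathfrak{S}_m$ be the symmetric group on $\{1,\dots,m\}$, let $\mathrm{exc}(w)$ be the number of $i$ with $w(i)>i$, let $A_m(x)=\sum_{w\in\mathfrak{S}_m}x^{\mathrm{exc}(w)}$ be the Eulerian polynomial, and let $d_m(x)=\sum_w x^{\mathrm{exc}(w)}$, summed over all $w\in\mathfrak{S}_m$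 without fixed points, be the derangement polynomial (so $d_0(x)=1$). Then: 1. $$\ell_V(\mathrm{sd}^{(2)}(2^V),x)=\sum\binom{n}{n_0,n_1,\dots,n_k}\,d_k(x)\,d_{n_0}(x)\,A_{n_1}(x)\cdots A_{n_k}(x),$$ where the sum ranges over all $k\ge 0$ and all sequences $(n_0,n_1,\dots,n_k)$ of integers with $n_0\ge 0$ and $n_1,\dots,n_k\ge 1$ which sum to $n$. 2. The polynomial $\ell_V(\mathrm{sd}^{(2)}(2^V),x)$ is $\gamma$-positive with center of symmetry $n/2$, i.e. it equals $\sum_{i=0}^{\lfloor n/2\rfloor}\gamma_i\,x^i(1+x)^{n-2i}$ for some nonnegative real numbers $\gamma_0,\gamma_1,\dots,\gamma_{\lfloor n/2\rfloor}$. 3. The sum of the coefficients of $\ell_V(\mathrm{sd}^{(2)}(2^V),x)$ equals the number of pairs $(u,v)\in\mathfrak{S}_n\times\mathfrak{S}_n$ which have no common fixed point. -/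

import Mathlib

open Polynomial

/-! ### Face numbers and the `h`-polynomial

A `PreAbstractSimplicialComplex` records only the nonempty faces of a simplicial complex; the empty
face is always understood to be present, so the complex without nonempty faces is `{∅}`. -/

namespace PreAbstractSimplicialComplex

variable {ι : Type*}

/-- The number `f_{i-1}` of faces with `i` vertices; `f_{-1} = 1` counts the empty face. -/
noncomputable def faceCount (K : PreAbstractSimplicialComplex ι) (i : ℕ) : ℕ :=
  if i = 0 then 1 else {s : Finset ι | s ∈ K.faces ∧ s.card = i}.ncard

/-- The maximal number of vertices of a face, i.e. one more than the dimension (for a finite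
complex). It is `0` for the complex `{∅}`, of dimension `-1`. -/
noncomputable def rank (K : PreAbstractSimplicialComplex ι) : ℕ :=
  sSup (Finset.card '' K.faces)

/-- The `h`-polynomial `∑_{i=0}^{n} f_{i-1} x^i (1-x)^{n-i}` of a finite simplicial complex of
dimension `n - 1`. -/
noncomputable def hPolynomial (K : PreAbstractSimplicialComplex ι) : ℝ[X] :=
  ∑ i ∈ Finset.range (K.rank + 1),
    (K.faceCount i : ℝ[X]) * X ^ i * (1 - X) ^ (K.rank - i)

/-- The barycentric subdivision: the vertices are the nonempty faces of `K`, and the (nonempty)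
faces are the (nonempty, finite) chains of nonempty faces of `K` ordered by inclusion. -/
def barycentricSubdivision (K : PreAbstractSimplicialComplex ι) :
    PreAbstractSimplicialComplex (Finset ι) where
  faces := {C | C.Nonempty ∧ (∀ E ∈ C, E ∈ K.faces) ∧
    IsChain (fun A B : Finset ι => A ⊆ B) (C : Set (Finset ι))}
  isRelLowerSet_faces := fun _ hC =>
    ⟨hC.1, fun _ hDC hD =>
      ⟨hD, fun E hE => hC.2.1 E (hDC hE), hC.2.2.mono (Finset.coe_subset.2 hDC)⟩⟩

end PreAbstractSimplicialComplex

/-! ### Subdivisions of a simplex and the local `h`-polynomial -/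

/-- A simplicial complex in which each vertex is assigned a face of the simplex `2^V`. For a
triangulation of `2^V`, the carrier of a vertex is the smallest face of `2^V` which contains it, and
the carrier of a face of the triangulation is the union of the carriers of its vertices. -/
structure CarriedComplex (V ι : Type*) where
  /-- the underlying simplicial complex -/
  complex : PreAbstractSimplicialComplex ι
  /-- the carrier of each vertex -/
  carrier : ι → Finset V

namespace CarriedComplex

variable {V ι : Type*}

/-- The trivial triangulation of `2^V`: all nonempty finite sets of elements of `V` are faces and
the vertex `v` is carried by `{v}`. -/
def simplex (V : Type*) : CarriedComplex V V where
  complex := ⊤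
  carrier := fun v => {v}

/-- The barycentric subdivision of a triangulation `Γ` of `2^V`, viewed as a triangulation of
`2^V`. The vertex given by a face `E` of `Γ` (its barycenter) lies in the relative interior of `E`,
so it has the same carrier as `E`. -/
def sd [DecidableEq V] (Γ : CarriedComplex V ι) : CarriedComplex V (Finset ι) where
  complex := Γ.complex.barycentricSubdivision
  carrier := fun E => E.biUnion Γ.carrier

/-- The restriction `Γ_F` of `Γ` to the face `F` of `2^V`: all faces of `Γ` contained in `F`. -/
def restrict (Γ : CarriedComplex V ι) (F : Finset V) : PreAbstractSimplicialComplex ι where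
  faces := {E | E ∈ Γ.complex.faces ∧ ∀ v ∈ E, Γ.carrier v ⊆ F}
  isRelLowerSet_faces := fun _ hE =>
    ⟨(Γ.complex.isRelLowerSet_faces hE.1).1, fun _ hDE hD =>
      ⟨(Γ.complex.isRelLowerSet_faces hE.1).2 hDE hD, fun v hv => hE.2 v (hDE hv)⟩⟩

/-- The local `h`-polynomial `ℓ_V(Γ, x) = ∑_{F ⊆ V} (-1)^{|V| - |F|} h(Γ_F, x)`. -/
noncomputable def localH [Fintype V] (Γ : CarriedComplex V ι) : ℝ[X] :=
  ∑ F : Finset V, (-1) ^ (Fintype.card V - F.card) * (Γ.restrict F).hPolynomial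

end CarriedComplex

/-! ### Eulerian and derangement polynomials, gamma-positivity -/

/-- The number of excedances of a permutation. -/
def excedances {n : ℕ} (w : Equiv.Perm (Fin n)) : ℕ :=
  (Finset.univ.filter fun i => i < w i).card

/-- The Eulerian polynomial `A_n(x) = ∑_{w ∈ S_n} x^{exc(w)}`. -/
noncomputable def eulerianPoly (n : ℕ) : ℝ[X] :=
  ∑ w : Equiv.Perm (Fin n), X ^ excedances w

/-- The derangement polynomial `d_n(x)`, the sum of `x^{exc(w)}` over all derangements `w ∈ S_n`. -/
noncomputable def derangementPoly (n : ℕ) : ℝ[X] :=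
  ∑ w : derangements (Fin n), X ^ excedances (w : Equiv.Perm (Fin n))

/-- `f` is gamma-positive with center of symmetry `n/2`:
`f(x) = ∑_{i=0}^{⌊n/2⌋} γ_i x^i (1+x)^{n-2i}` for some nonnegative reals `γ_i`. -/
def IsGammaPositive (n : ℕ) (f : ℝ[X]) : Prop :=
  ∃ γ : ℕ → ℝ, (∀ i, 0 ≤ γ i) ∧
    f = ∑ i ∈ Finset.range (n / 2 + 1), C (γ i) * X ^ i * (1 + X) ^ (n - 2 * i)

/-! Chains of sets with `j` members and a given union are counted by ordered partitions, so the face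
numbers of each restriction depend only on `|F|`, and the local `h`-polynomial is a binomial
alternating sum over `m = |F|`. In exponential generating functions this sum is multiplication by
`e^{-z}`.

Let `D`, `A` be the series of the `d_n` and `A_n`, and put `y = (e^{(1-x)z} - 1)/(1-x)` and `W = 1 +
x(A - 1)`. Splitting permutations by their fixed points gives `A = D e^z`. Weak excedances have the
distribution of excedances shifted by one, so `W = D e^{xz}`. Hence `W = 1/(1 - xy)`, `A - 1 = yW`
and `D = e^{-xz} W`.

Powers of `y` count ordered partitions, so the `h`-polynomials have series `e^{(1-x)z} ∑_r P_r y^r`,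
where the series of the `P_r` is `W = D e^{xz}`, that is, `P_r = ∑_k (r choose k) d_k x^{r-k}`.
Since `∑_r (r choose k) x^{r-k} y^r = y^k W^{k+1}`, the inner sum is `W ∑_k d_k (A - 1)^k`.
Multiplying by `e^{(1-x)z} e^{-z} = e^{-xz}` leaves `D ∑_k d_k (A - 1)^k`, whose coefficients are
the stated formula (`sdSdLocalH_eq`).

For gamma-positivity, `D' = x(A-1)D` and `A' = 1 + (1+x)(A-1) + x(A-1)^2` give recurrences with
gamma-positive terms: `d_n` has center `n/2` and `A_n` has center `(n-1)/2` for `n ≥ 1`. At `x = 1`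
each `h`-polynomial counts facets, `(m!)^2` of them, and the alternating sum is inclusion–exclusion
over common fixed points. -/

/-! ### Counting chains -/

/-- The number of ordered partitions of a set with `r` elements into `j` nonempty blocks. -/
def orderedPartitionCount (r : ℕ) : ℕ → ℕ
  | 0 => if r = 0 then 1 else 0
  | j + 1 => ∑ s : Fin r, r.choose s * orderedPartitionCount s j

theorem orderedPartitionCount_zero_right (r : ℕ) :
    orderedPartitionCount r 0 = if r = 0 then 1 else 0 := by
  rw [orderedPartitionCount]

theorem orderedPartitionCount_succ (r j : ℕ) : orderedPartitionCount r (j + 1) =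
    ∑ s ∈ Finset.range r, r.choose s * orderedPartitionCount s j := by
  rw [orderedPartitionCount, Finset.sum_range]

theorem orderedPartitionCount_eq_zero_of_lt {r j : ℕ} (h : r < j) :
    orderedPartitionCount r j = 0 := by
  induction j generalizing r with
  | zero => omega
  | succ j ih =>
    rw [orderedPartitionCount_succ]
    refine Finset.sum_eq_zero fun s hs => ?_
    rw [ih (by have := Finset.mem_range.1 hs; omega), mul_zero]

theorem orderedPartitionCount_self (r : ℕ) : orderedPartitionCount r r = r.factorial := by
  induction r with
  | zero => simp [orderedPartitionCount_zero_right]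
  | succ r ih =>
    rw [orderedPartitionCount_succ, Finset.sum_range_succ, Finset.sum_eq_zero, ih,
      Nat.choose_succ_self_right, Nat.factorial_succ, zero_add]
    intro s hs
    rw [orderedPartitionCount_eq_zero_of_lt (Finset.mem_range.1 hs), mul_zero]

open Classical in
/-- The chains of `j` nonempty finite sets whose largest member is `G` (for `j = 0`, the empty
chain if `G = ∅`). -/
noncomputable def chainsWithUnion {ι : Type*} (G : Finset ι) (j : ℕ) : Finset (Finset (Finset ι)) :=
  G.powerset.powerset.filter fun C => ∅ ∉ C ∧
    IsChain (fun A B : Finset ι => A ⊆ B) (C : Set (Finset ι)) ∧ C.card = j ∧ C.sup id = G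

open Classical in
theorem mem_chainsWithUnion {ι : Type*} {G : Finset ι} {j : ℕ} {C : Finset (Finset ι)} :
    C ∈ chainsWithUnion G j ↔ ∅ ∉ C ∧
      IsChain (fun A B : Finset ι => A ⊆ B) (C : Set (Finset ι)) ∧ C.card = j ∧ C.sup id = G := by
  rw [chainsWithUnion, Finset.mem_filter, and_iff_right_of_imp]
  rintro ⟨-, -, -, rfl⟩
  refine Finset.mem_powerset.2 fun A hA => Finset.mem_powerset.2 ?_
  exact Finset.le_sup (f := id) hA

open Classical in
theorem IsChain.sup_mem_of_nonempty {ι : Type*} {C : Finset (Finset ι)}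
    (h : IsChain (fun A B : Finset ι => A ⊆ B) (C : Set (Finset ι))) (hC : C.Nonempty) :
    C.sup id ∈ C := by
  obtain ⟨A, hA, hmax⟩ := C.exists_max_image Finset.card hC
  have : C.sup id = A := by
    refine le_antisymm (Finset.sup_le fun B hB => ?_) (Finset.le_sup (f := id) hA)
    rcases h.total hA hB with h' | h'
    · exact (Finset.eq_of_subset_of_card_le h' (hmax B hB)).ge
    · exact h'
  rwa [this]

open Classical in
theorem sum_ssubsets_apply_card {ι : Type*} (G : Finset ι) (f : ℕ → ℕ) :
    ∑ A ∈ G.ssubsets, f A.card = ∑ s ∈ Finset.range G.card, G.card.choose s * f s := by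
  have h := Finset.sum_powerset_apply_card f (x := G)
  rw [Finset.sum_range_succ, ← Finset.sum_erase_add _ _ (Finset.mem_powerset_self G)] at h
  simpa [Finset.ssubsets] using h

-- Deleting the top member `G` leaves a chain whose union is a proper subset of `G`; this is the
-- recurrence for ordered partitions, with the complement of that subset as a block.
open Classical in
theorem card_chainsWithUnion {ι : Type*} (G : Finset ι) (j : ℕ) :
    (chainsWithUnion G j).card = orderedPartitionCount G.card j := by
  induction j generalizing G with
  | zero =>
    rw [orderedPartitionCount_zero_right]
    split_ifs with h
    · rw [Finset.card_eq_zero] at h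
      subst h
      rw [Finset.card_eq_one]
      refine ⟨∅, ?_⟩
      ext C
      rw [mem_chainsWithUnion, Finset.mem_singleton, Finset.card_eq_zero]
      constructor
      · exact fun h => h.2.2.1
      · rintro rfl; simp
    · rw [Finset.card_eq_zero, Finset.eq_empty_iff_forall_notMem]
      intro C hC
      rw [mem_chainsWithUnion, Finset.card_eq_zero] at hC
      obtain ⟨-, -, rfl, h'⟩ := hC
      exact h (by rw [← h']; simp)
  | succ j ih =>
    rw [orderedPartitionCount_succ,
      ← sum_ssubsets_apply_card G (fun s => orderedPartitionCount s j),
      ← Finset.sum_congr rfl fun A _ => ih A, ← Finset.card_sigma]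
    refine Finset.card_nbij' (fun C => ⟨(C.erase G).sup id, C.erase G⟩) (fun p => insert G p.2)
      ?_ ?_ ?_ ?_
    · intro C hC
      rw [Finset.mem_coe, mem_chainsWithUnion] at hC
      obtain ⟨h0, hch, hcard, hsup⟩ := hC
      have hne : C.Nonempty := Finset.card_pos.1 (by omega)
      have hG : G ∈ C := hsup ▸ hch.sup_mem_of_nonempty hne
      have hch' := hch.mono (Finset.coe_subset.2 (C.erase_subset G))
      rw [Finset.mem_coe, Finset.mem_sigma, mem_chainsWithUnion, Finset.mem_ssubsets]
      refine ⟨?_, fun h => h0 (Finset.mem_of_mem_erase h), hch', ?_, rfl⟩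
      -- If the remaining chain still had union `G`, either it is empty and `G = ∅` was a member, or
      -- it contains its own union, which has been erased.
      · refine lt_of_le_of_ne ((Finset.sup_mono (C.erase_subset G)).trans hsup.le) fun h => ?_
        dsimp only at h
        rcases (C.erase G).eq_empty_or_nonempty with h' | h'
        · rw [h', Finset.sup_empty] at h
          exact h0 (by rw [← Finset.bot_eq_empty, h]; exact hG)
        · have := hch'.sup_mem_of_nonempty h'
          rw [h] at this
          simp at this
      · rw [Finset.card_erase_of_mem hG, hcard]; rfl
    · rintro ⟨A, C⟩ hC
      rw [Finset.mem_coe, Finset.mem_sigma, mem_chainsWithUnion, Finset.mem_ssubsets] at hC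
      obtain ⟨hA, h0, hch, hcard, hsup⟩ := hC
      dsimp only at *
      have hle : ∀ B ∈ C, B ⊆ A := fun B hB => hsup ▸ Finset.le_sup (f := id) hB
      rw [Finset.mem_coe, mem_chainsWithUnion]
      refine ⟨?_, ?_, ?_, ?_⟩
      · rw [Finset.mem_insert, not_or]
        exact ⟨fun h => by subst h; exact absurd hA (Finset.not_ssubset_empty _), h0⟩
      · rw [Finset.coe_insert]
        exact hch.insert fun B hB _ => Or.inr ((hle B hB).trans hA.1)
      · rw [Finset.card_insert_of_notMem fun h => hA.2 (hle G h), hcard]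
      · rw [Finset.sup_insert, hsup]
        exact sup_of_le_left hA.1
    · intro C hC
      rw [Finset.mem_coe, mem_chainsWithUnion] at hC
      obtain ⟨h0, hch, hcard, hsup⟩ := hC
      have hne : C.Nonempty := Finset.card_pos.1 (by omega)
      exact Finset.insert_erase (hsup ▸ hch.sup_mem_of_nonempty hne)
    · rintro ⟨A, C⟩ hC
      rw [Finset.mem_coe, Finset.mem_sigma, mem_chainsWithUnion, Finset.mem_ssubsets] at hC
      obtain ⟨hA, h0, hch, hcard, hsup⟩ := hC
      dsimp only at *
      have hG : G ∉ C := fun h => hA.2 (hsup ▸ Finset.le_sup (f := id) h)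
      rw [Finset.erase_insert hG, hsup]

/-! ### Face numbers of subdivisions and their restrictions -/

namespace PreAbstractSimplicialComplex

variable {ι : Type*}

open Classical in
/-- Face numbers of the barycentric subdivision. -/
theorem faceCount_barycentricSubdivision [Finite ι] (K : PreAbstractSimplicialComplex ι) {N : ℕ}
    (hN : ∀ s ∈ K.faces, s.card ≤ N) (j : ℕ) :
    K.barycentricSubdivision.faceCount j =
      ∑ r ∈ Finset.range (N + 1), K.faceCount r * orderedPartitionCount r j := by
  have := Fintype.ofFinite ι
  rcases Nat.eq_zero_or_pos j with rfl | hj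
  · simp [faceCount, orderedPartitionCount_zero_right]
  set T : Finset (Finset ι) := Finset.univ.filter (· ∈ K.faces) with hT
  -- Chains are sorted by largest member: it is a face, and conversely all members of a chain below
  -- a face are faces because `K` is closed under nonempty subsets.
  have hset : {C : Finset (Finset ι) | C ∈ K.barycentricSubdivision.faces ∧ C.card = j} =
      (T.biUnion fun G => chainsWithUnion G j : Finset (Finset (Finset ι))) := by
    ext C
    simp only [barycentricSubdivision, Set.mem_ofPred_eq, Finset.coe_biUnion, Set.mem_iUnion,
      Finset.mem_coe, mem_chainsWithUnion, hT, Finset.mem_filter, Finset.mem_univ, true_and,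
      exists_prop]
    constructor
    · rintro ⟨⟨hne, hf, hch⟩, hcard⟩
      exact ⟨C.sup id, hf _ (hch.sup_mem_of_nonempty hne),
        fun h => Finset.not_nonempty_empty (K.isRelLowerSet_faces (hf _ h)).1, hch, hcard, rfl⟩
    · rintro ⟨G, hG, h0, hch, hcard, hsup⟩
      refine ⟨⟨Finset.card_pos.1 (by omega), fun E hE => ?_, hch⟩, hcard⟩
      refine (K.isRelLowerSet_faces hG).2 (hsup ▸ Finset.le_sup (f := id) hE) ?_
      exact Finset.nonempty_iff_ne_empty.2 fun h => h0 (h ▸ hE)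
  rw [faceCount, if_neg hj.ne', hset, Set.ncard_coe_finset, Finset.card_biUnion]
  · simp_rw [card_chainsWithUnion]
    rw [← Finset.sum_fiberwise_of_maps_to (t := Finset.range (N + 1)) (g := Finset.card)]
    · refine Finset.sum_congr rfl fun r _ => ?_
      rw [Finset.sum_congr rfl fun G hG => by rw [(Finset.mem_filter.1 hG).2], Finset.sum_const,
        smul_eq_mul]
      rcases Nat.eq_zero_or_pos r with rfl | hr
      · simp [orderedPartitionCount_eq_zero_of_lt hj]
      · rw [faceCount, if_neg hr.ne', ← Set.ncard_coe_finset]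
        simp [hT]
    · intro G hG
      exact Finset.mem_range.2 (Nat.lt_succ_of_le (hN G (Finset.mem_filter.1 hG).2))
  · intro G _ H _ hGH
    rw [Function.onFun, Finset.disjoint_left]
    intro C hC hC'
    rw [mem_chainsWithUnion] at hC hC'
    exact hGH (hC.2.2.2 ▸ hC'.2.2.2)

theorem faceCount_ne_zero_iff [Finite ι] (K : PreAbstractSimplicialComplex ι) {i : ℕ}
    (hi : i ≠ 0) : K.faceCount i ≠ 0 ↔ ∃ s ∈ K.faces, s.card = i := by
  rw [faceCount, if_neg hi, ← Nat.pos_iff_ne_zero, Set.ncard_pos]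
  rfl

theorem card_le_of_faceCount_eq_zero [Finite ι] (K : PreAbstractSimplicialComplex ι) {m : ℕ}
    (h : ∀ i, m < i → K.faceCount i = 0) : ∀ s ∈ K.faces, s.card ≤ m := by
  intro s hs
  by_contra! hlt
  exact (K.faceCount_ne_zero_iff (by omega)).2 ⟨s, hs, rfl⟩ (h _ hlt)

theorem rank_eq_of_faceCount [Finite ι] (K : PreAbstractSimplicialComplex ι) {m : ℕ}
    (h : ∀ i, m < i → K.faceCount i = 0) (hm : K.faceCount m ≠ 0) : K.rank = m := by
  have hle := K.card_le_of_faceCount_eq_zero h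
  rcases Nat.eq_zero_or_pos m with rfl | hpos
  · have : K.faces = ∅ := Set.eq_empty_iff_forall_notMem.2 fun s hs => by
      have := Finset.card_pos.2 (K.isRelLowerSet_faces hs).1
      have := hle s hs
      omega
    simp [rank, this]
  · obtain ⟨s, hs, hcard⟩ := (K.faceCount_ne_zero_iff hpos.ne').1 hm
    exact IsGreatest.csSup_eq ⟨⟨s, hs, hcard⟩, by rintro _ ⟨t, ht, rfl⟩; exact hle t ht⟩

end PreAbstractSimplicialComplex

namespace CarriedComplex

variable {V ι : Type*}

theorem restrict_sd [DecidableEq V] (Γ : CarriedComplex V ι) (F : Finset V) :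
    Γ.sd.restrict F = (Γ.restrict F).barycentricSubdivision := by
  ext C
  simp only [restrict, sd, PreAbstractSimplicialComplex.barycentricSubdivision, Set.mem_ofPred_eq,
    Finset.biUnion_subset]
  constructor
  · rintro ⟨⟨h1, h2, h3⟩, h4⟩
    exact ⟨h1, fun E hE => ⟨h2 E hE, h4 E hE⟩, h3⟩
  · rintro ⟨h1, h2, h3⟩
    exact ⟨⟨h1, fun E hE => (h2 E hE).1, h3⟩, fun E hE => (h2 E hE).2⟩

theorem faceCount_restrict_simplex (F : Finset V) (r : ℕ) :
    ((simplex V).restrict F).faceCount r = F.card.choose r := by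
  rcases Nat.eq_zero_or_pos r with rfl | hr
  · simp [PreAbstractSimplicialComplex.faceCount]
  · rw [PreAbstractSimplicialComplex.faceCount, if_neg hr.ne', ← Finset.card_powersetCard,
      ← Set.ncard_coe_finset]
    congr 1
    ext E
    simp only [restrict, simplex, Finset.singleton_subset_iff, Set.mem_ofPred_eq,
      Finset.mem_coe, Finset.mem_powersetCard]
    rw [and_comm (a := E ⊆ F), and_comm, and_congr_right_iff]
    intro hE
    refine ⟨fun h => h.2, fun h => ⟨Finset.card_pos.1 (by omega), h⟩⟩

end CarriedComplex

/-- The number of faces with `r` vertices of the barycentric subdivision of the simplex with `m`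
vertices. -/
def sdFaceCount (m r : ℕ) : ℕ :=
  ∑ s ∈ Finset.range (m + 1), m.choose s * orderedPartitionCount s r

/-- The number of faces with `i` vertices of the second barycentric subdivision of the simplex with
`m` vertices. -/
def sdSdFaceCount (m i : ℕ) : ℕ :=
  ∑ r ∈ Finset.range (m + 1), sdFaceCount m r * orderedPartitionCount r i

theorem sdFaceCount_eq_zero_of_lt {m r : ℕ} (h : m < r) : sdFaceCount m r = 0 :=
  Finset.sum_eq_zero fun s hs => by
    rw [orderedPartitionCount_eq_zero_of_lt (by have := Finset.mem_range.1 hs; omega), mul_zero]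

theorem sdFaceCount_self (m : ℕ) : sdFaceCount m m = m.factorial := by
  rw [sdFaceCount, Finset.sum_range_succ, Finset.sum_eq_zero, Nat.choose_self, one_mul, zero_add,
    orderedPartitionCount_self]
  intro s hs
  rw [orderedPartitionCount_eq_zero_of_lt (Finset.mem_range.1 hs), mul_zero]

theorem sdSdFaceCount_eq_zero_of_lt {m i : ℕ} (h : m < i) : sdSdFaceCount m i = 0 :=
  Finset.sum_eq_zero fun s hs => by
    rw [orderedPartitionCount_eq_zero_of_lt (by have := Finset.mem_range.1 hs; omega), mul_zero]

theorem sdSdFaceCount_self (m : ℕ) : sdSdFaceCount m m = m.factorial ^ 2 := by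
  rw [sdSdFaceCount, Finset.sum_range_succ, Finset.sum_eq_zero, zero_add,
    orderedPartitionCount_self, sdFaceCount_self, sq]
  intro s hs
  rw [orderedPartitionCount_eq_zero_of_lt (Finset.mem_range.1 hs), mul_zero]

/-- The `h`-polynomial of the second barycentric subdivision of the simplex with `m` vertices. -/
noncomputable def sdSdH (m : ℕ) : ℝ[X] :=
  ∑ i ∈ Finset.range (m + 1), (sdSdFaceCount m i : ℝ[X]) * X ^ i * (1 - X) ^ (m - i)

namespace CarriedComplex

variable {V : Type*} [Fintype V] [DecidableEq V]

theorem faceCount_restrict_simplex_sd (F : Finset V) (r : ℕ) :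
    ((simplex V).sd.restrict F).faceCount r = sdFaceCount F.card r := by
  rw [restrict_sd, PreAbstractSimplicialComplex.faceCount_barycentricSubdivision (N := F.card)]
  · simp_rw [faceCount_restrict_simplex]
    rfl
  · refine PreAbstractSimplicialComplex.card_le_of_faceCount_eq_zero _ fun i hi => ?_
    rw [faceCount_restrict_simplex, Nat.choose_eq_zero_of_lt hi]

theorem faceCount_restrict_simplex_sd_sd (F : Finset V) (i : ℕ) :
    ((simplex V).sd.sd.restrict F).faceCount i = sdSdFaceCount F.card i := by
  rw [restrict_sd, PreAbstractSimplicialComplex.faceCount_barycentricSubdivision (N := F.card)]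
  · simp_rw [faceCount_restrict_simplex_sd]
    rfl
  · refine PreAbstractSimplicialComplex.card_le_of_faceCount_eq_zero _ fun i hi => ?_
    rw [faceCount_restrict_simplex_sd, sdFaceCount_eq_zero_of_lt hi]

theorem hPolynomial_restrict_simplex_sd_sd (F : Finset V) :
    ((simplex V).sd.sd.restrict F).hPolynomial = sdSdH F.card := by
  have hrank : ((simplex V).sd.sd.restrict F).rank = F.card := by
    refine PreAbstractSimplicialComplex.rank_eq_of_faceCount _ (fun i hi => ?_) ?_
    · rw [faceCount_restrict_simplex_sd_sd, sdSdFaceCount_eq_zero_of_lt hi]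
    · rw [faceCount_restrict_simplex_sd_sd, sdSdFaceCount_self]
      positivity
  simp_rw [PreAbstractSimplicialComplex.hPolynomial, hrank, faceCount_restrict_simplex_sd_sd]
  rfl

theorem localH_simplex_sd_sd : (simplex V).sd.sd.localH =
    ∑ m ∈ Finset.range (Fintype.card V + 1),
      ((Fintype.card V).choose m : ℝ[X]) * ((-1) ^ (Fintype.card V - m) * sdSdH m) := by
  simp_rw [localH, hPolynomial_restrict_simplex_sd_sd]
  rw [← Finset.powerset_univ, Finset.sum_powerset_apply_card
    (fun m => (-1) ^ (Fintype.card V - m) * sdSdH m)]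
  simp [Finset.card_univ, nsmul_eq_mul]

end CarriedComplex

/-! ### Excedances and fixed points -/

/-- The relabelling is increasing, and the points outside `S` are fixed, so they contribute no
excedance. -/
theorem excedances_extendDomain {m : ℕ} (S : Finset (Fin m)) (σ : Equiv.Perm (Fin S.card)) :
    excedances (σ.extendDomain (S.orderIsoOfFin rfl).toEquiv) = excedances σ := by
  symm
  refine Finset.card_nbij (fun a => (S.orderIsoOfFin rfl a : Fin m)) ?_ ?_ ?_
  · intro a ha
    rw [Finset.mem_coe, Finset.mem_filter] at ha ⊢
    refine ⟨Finset.mem_univ _, ?_⟩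
    have := σ.extendDomain_apply_image (S.orderIsoOfFin rfl).toEquiv a
    rw [RelIso.coe_fn_toEquiv] at this
    rw [this]
    exact (S.orderIsoOfFin rfl).lt_iff_lt.2 ha.2
  · intro a _ b _ h
    exact (S.orderIsoOfFin rfl).injective (Subtype.ext h)
  · intro i hi
    rw [Finset.mem_coe, Finset.mem_filter] at hi
    have hiS : i ∈ S := by
      by_contra h
      rw [Equiv.Perm.extendDomain_apply_not_subtype _ _ h] at hi
      exact lt_irrefl _ hi.2
    obtain ⟨a, ha⟩ := (S.orderIsoOfFin rfl).surjective ⟨i, hiS⟩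
    have hai : (S.orderIsoOfFin rfl a : Fin m) = i := by rw [ha]
    refine ⟨a, ?_, hai⟩
    rw [Finset.mem_coe, Finset.mem_filter]
    refine ⟨Finset.mem_univ _, ?_⟩
    have := σ.extendDomain_apply_image (S.orderIsoOfFin rfl).toEquiv a
    rw [RelIso.coe_fn_toEquiv] at this
    rw [← hai, this] at hi
    exact (S.orderIsoOfFin rfl).lt_iff_lt.1 hi.2

theorem sum_excedances_of_support_eq {m : ℕ} (S : Finset (Fin m)) :
    ∑ w : Equiv.Perm (Fin m) with w.support = S, (X : ℝ[X]) ^ excedances w =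
      derangementPoly S.card := by
  symm
  set e := (S.orderIsoOfFin rfl).toEquiv with he
  refine Finset.sum_bij
    (fun (σ : derangements (Fin S.card)) _ => (σ : Equiv.Perm (Fin S.card)).extendDomain e)
    ?_ ?_ ?_ ?_
  · rintro ⟨σ, hσ⟩ -
    rw [Finset.mem_filter]
    refine ⟨Finset.mem_univ _, ?_⟩
    ext i
    rw [Equiv.Perm.mem_support]
    constructor
    · intro h
      by_contra hi
      exact h (Equiv.Perm.extendDomain_apply_not_subtype _ _ hi)
    · intro hi
      obtain ⟨a, ha⟩ := e.surjective ⟨i, hi⟩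
      have hai : (e a : Fin m) = i := by rw [ha]
      rw [← hai, Equiv.Perm.extendDomain_apply_image]
      exact fun h => hσ a (e.injective (Subtype.ext h))
  · rintro σ - τ - h
    exact Subtype.ext (Equiv.Perm.extendDomainHom_injective e h)
  · intro w hw
    rw [Finset.mem_filter] at hw
    have hmem : ∀ i, w i ∈ S ↔ i ∈ S := fun i => by
      rw [← hw.2, Equiv.Perm.apply_mem_support]
    refine ⟨⟨e.symm.permCongr (w.subtypePerm hmem), ?_⟩, Finset.mem_univ _, ?_⟩
    · intro a h
      have h1 : (w.subtypePerm hmem (e a) : Fin m) = e a := by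
        rw [Equiv.permCongr_apply, Equiv.symm_symm, Equiv.symm_apply_eq] at h
        rw [h]
      rw [Equiv.Perm.subtypePerm_apply] at h1
      have h2 : (e a : Fin m) ∈ w.support := hw.2 ▸ (e a).2
      exact Equiv.Perm.mem_support.1 h2 h1
    · ext1 i
      by_cases hi : i ∈ S
      · obtain ⟨a, ha⟩ := e.surjective ⟨i, hi⟩
        have hai : (e a : Fin m) = i := by rw [ha]
        rw [← hai, Equiv.Perm.extendDomain_apply_image]
        simp
      · rw [Equiv.Perm.extendDomain_apply_not_subtype _ _ hi]
        rw [← hw.2, Equiv.Perm.notMem_support] at hi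
        exact hi.symm
  · rintro σ -
    rw [excedances_extendDomain]

/-- The joint distribution of excedances and fixed points. -/
theorem sum_excedances_fixedPoints (m : ℕ) (u : ℝ[X]) :
    ∑ w : Equiv.Perm (Fin m), X ^ excedances w * u ^ (m - w.support.card) =
      ∑ k ∈ Finset.range (m + 1), (m.choose k : ℝ[X]) * (derangementPoly k * u ^ (m - k)) := by
  have h := Finset.sum_powerset_apply_card (fun k => derangementPoly k * u ^ (m - k))
    (x := (Finset.univ : Finset (Fin m)))
  simp only [Finset.card_univ, Fintype.card_fin, nsmul_eq_mul, Finset.powerset_univ] at h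
  rw [← h, ← Finset.sum_fiberwise (g := Equiv.Perm.support)]
  refine Finset.sum_congr rfl fun S _ => ?_
  rw [← sum_excedances_of_support_eq, Finset.sum_mul]
  refine Finset.sum_congr rfl fun w hw => ?_
  rw [(Finset.mem_filter.1 hw).2]

theorem eulerianPoly_eq_sum_derangementPoly (m : ℕ) :
    eulerianPoly m = ∑ k ∈ Finset.range (m + 1), (m.choose k : ℝ[X]) * derangementPoly k := by
  simpa [eulerianPoly] using sum_excedances_fixedPoints m 1

/-- The left side counts weak excedances. Rotating the values by one turns `i ≤ w i` into a strict
excedance, except where `w i` is the last point: that weak excedance is lost because the value wraps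
to `0`. -/
theorem excedances_add_fixedPoints {p : ℕ} (w : Equiv.Perm (Fin (p + 1))) :
    excedances w + (p + 1 - w.support.card) = excedances (finRotate (p + 1) * w) + 1 := by
  have hfix : p + 1 - w.support.card = (Finset.univ.filter fun i => i = w i).card := by
    have h1 : w.supportᶜ = Finset.univ.filter fun i => i = w i := by
      ext i
      simp [eq_comm]
    rw [← h1, Finset.card_compl, Fintype.card_fin]
  have hlast : w.symm (Fin.last p) ∉
      Finset.univ.filter fun i => i < (finRotate (p + 1) * w) i := by
    simp
  rw [hfix, excedances, excedances, ← Finset.card_insert_of_notMem hlast,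
    ← Finset.card_union_of_disjoint]
  · congr 1
    ext i
    simp only [Finset.mem_union, Finset.mem_filter, Finset.mem_univ, true_and, Finset.mem_insert]
    rw [Equiv.Perm.mul_apply, Equiv.eq_symm_apply]
    by_cases h : w i = Fin.last p
    · simp only [h, true_or, iff_true]
      exact (Fin.le_last i).lt_or_eq
    · simp only [h, false_or]
      rw [Fin.lt_def (b := finRotate _ _), coe_finRotate_of_ne_last h, Nat.lt_succ_iff,
        ← Fin.le_def, le_iff_lt_or_eq]
  · rw [Finset.disjoint_filter]
    exact fun i _ h h' => h.ne h'

/-- Weak excedances are distributed as excedances, up to a shift by one. -/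
theorem X_mul_eulerianPoly_eq_sum_derangementPoly {m : ℕ} (hm : 0 < m) :
    X * eulerianPoly m =
      ∑ k ∈ Finset.range (m + 1), (m.choose k : ℝ[X]) * (derangementPoly k * X ^ (m - k)) := by
  obtain ⟨p, rfl⟩ : ∃ p, m = p + 1 := ⟨m - 1, by omega⟩
  rw [← sum_excedances_fixedPoints, eulerianPoly, Finset.mul_sum,
    ← Equiv.sum_comp (Equiv.mulLeft (finRotate (p + 1)))]
  refine Finset.sum_congr rfl fun w _ => ?_
  rw [← pow_add, excedances_add_fixedPoints, Equiv.coe_mulLeft, pow_succ']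

theorem derangementPoly_zero : derangementPoly 0 = 1 := by
  have := eulerianPoly_eq_sum_derangementPoly 0
  simpa [eulerianPoly, excedances] using this.symm

theorem eulerianPoly_zero : eulerianPoly 0 = 1 := by
  simp [eulerianPoly, excedances]

/-! ### Exponential generating functions -/

theorem derivative_mul_eq {A : Type*} [CommRing A] (f g : PowerSeries A) :
    PowerSeries.derivative A (f * g) =
    f * PowerSeries.derivative A g + PowerSeries.derivative A f * g := by
  rw [Derivation.leibniz, smul_eq_mul, smul_eq_mul, mul_comm g]

theorem derivative_sub_eq {A : Type*} [CommRing A] (f g : PowerSeries A) :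
    PowerSeries.derivative A (f - g) =
    PowerSeries.derivative A f - PowerSeries.derivative A g := map_sub _ _ _

section ExponentialGeneratingFunctions

variable {A : Type*} [CommRing A] [Algebra ℚ A]

/-- The exponential generating function `∑ f(n) z^n / n!`. -/
noncomputable def egf (f : ℕ → A) : PowerSeries A :=
  PowerSeries.mk fun n => algebraMap ℚ A (1 / n.factorial) * f n

theorem coeff_egf (f : ℕ → A) (n : ℕ) :
    PowerSeries.coeff n (egf f) = algebraMap ℚ A (1 / n.factorial) * f n :=
  PowerSeries.coeff_mk _ _

theorem algebraMap_inv_factorial_mul (n : ℕ) :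
    algebraMap ℚ A (1 / n.factorial) * (n.factorial : A) = 1 := by
  rw [← map_natCast (algebraMap ℚ A), ← map_mul, one_div,
    inv_mul_cancel₀ (by exact_mod_cast n.factorial_ne_zero), map_one]

theorem egf_injective : Function.Injective (egf : (ℕ → A) → PowerSeries A) := by
  intro f g h
  funext n
  have h1 := congrArg (fun p => (n.factorial : A) * PowerSeries.coeff n p) h
  simp only [coeff_egf, ← mul_assoc] at h1
  rwa [mul_comm (n.factorial : A), algebraMap_inv_factorial_mul, one_mul, one_mul] at h1

theorem egf_add (f g : ℕ → A) : egf f + egf g = egf fun n => f n + g n := by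
  ext n; simp [coeff_egf, mul_add]

theorem C_mul_egf (a : A) (f : ℕ → A) : PowerSeries.C a * egf f = egf fun n => a * f n := by
  ext n; rw [PowerSeries.coeff_C_mul, coeff_egf, coeff_egf]; ring

theorem egf_one : egf (fun n => if n = 0 then (1 : A) else 0) = 1 := by
  ext n
  rw [coeff_egf, PowerSeries.coeff_one]
  split_ifs with h
  · simp [h]
  · simp

theorem constantCoeff_egf (f : ℕ → A) : PowerSeries.constantCoeff (egf f) = f 0 := by
  rw [← PowerSeries.coeff_zero_eq_constantCoeff_apply, coeff_egf]
  simp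

theorem egf_mul (f g : ℕ → A) : egf f * egf g =
    egf fun n => ∑ k ∈ Finset.range (n + 1), (n.choose k : A) * (f k * g (n - k)) := by
  ext n
  rw [PowerSeries.coeff_mul, coeff_egf, Finset.mul_sum,
    Finset.Nat.sum_antidiagonal_eq_sum_range_succ
      fun i j => PowerSeries.coeff i (egf f) * PowerSeries.coeff j (egf g)]
  refine Finset.sum_congr rfl fun k hk => ?_
  have hk' : k ≤ n := Nat.lt_succ_iff.1 (Finset.mem_range.1 hk)
  have h : (1 / n.factorial : ℚ) * n.choose k = (1 / k.factorial) * (1 / (n - k).factorial) := by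
    rw [Nat.cast_choose ℚ hk']
    have := n.factorial_ne_zero
    field_simp
  rw [coeff_egf, coeff_egf, ← map_natCast (algebraMap ℚ A),
    ← mul_assoc (algebraMap ℚ A (1 / n.factorial)), ← map_mul, h, map_mul]
  ring

theorem derivative_egf (f : ℕ → A) :
    PowerSeries.derivative A (egf f) = egf fun n => f (n + 1) := by
  ext n
  rw [PowerSeries.coeff_derivative, coeff_egf, coeff_egf]
  have h : (1 / (n + 1).factorial : ℚ) * (n + 1) = 1 / n.factorial := by
    rw [Nat.factorial_succ]
    have := n.factorial_ne_zero
    push_cast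
    field_simp
  rw [← h, map_mul, map_add, map_one, map_natCast]
  ring

/-- The power series `exp (a z)`. -/
noncomputable def expSeries (a : A) : PowerSeries A := egf fun n => a ^ n

theorem expSeries_mul (a b : A) : expSeries a * expSeries b = expSeries (a + b) := by
  have h : ∀ c : A, expSeries c = PowerSeries.rescale c (PowerSeries.exp A) := fun c => by
    ext n
    rw [expSeries, coeff_egf, PowerSeries.coeff_rescale, PowerSeries.coeff_exp, mul_comm]
  rw [h, h, h, PowerSeries.exp_mul_exp_eq_exp_add]

theorem expSeries_zero : expSeries (0 : A) = 1 := by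
  rw [← egf_one, expSeries]
  congr 1
  funext n
  split_ifs with h <;> simp [h]

theorem derivative_expSeries (a : A) :
    PowerSeries.derivative A (expSeries a) = PowerSeries.C a * expSeries a := by
  rw [expSeries, derivative_egf, C_mul_egf]
  simp_rw [pow_succ']

end ExponentialGeneratingFunctions

/-! ### The generating functions of the Eulerian and derangement polynomials -/

/-- `∑ A_n(x) z^n / n!` -/
noncomputable def eulerianSeries : PowerSeries ℝ[X] := egf eulerianPoly

/-- `∑ d_n(x) z^n / n!` -/
noncomputable def derangementSeries : PowerSeries ℝ[X] := egf derangementPoly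

/-- The series `(exp ((1 - x) z) - 1) / (1 - x)`. -/
noncomputable def scaledExpSeries : PowerSeries ℝ[X] :=
  egf fun r => if r = 0 then 0 else (1 - X) ^ (r - 1)

/-- The series `1 + x ∑_{n ≥ 1} A_n(x) z^n / n!`. -/
noncomputable def weakEulerianSeries : PowerSeries ℝ[X] :=
  egf fun j => if j = 0 then 1 else X * eulerianPoly j

theorem eulerianSeries_eq : eulerianSeries = derangementSeries * expSeries 1 := by
  rw [eulerianSeries, derangementSeries, expSeries, egf_mul]
  congr 1
  funext n
  simp [eulerianPoly_eq_sum_derangementPoly]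

theorem weakEulerianSeries_eq : weakEulerianSeries = derangementSeries * expSeries X := by
  rw [weakEulerianSeries, derangementSeries, expSeries, egf_mul]
  congr 1
  funext n
  split_ifs with h
  · simp [h, derangementPoly_zero]
  · rw [X_mul_eulerianPoly_eq_sum_derangementPoly (Nat.pos_of_ne_zero h)]

theorem weakEulerianSeries_eq_add :
    weakEulerianSeries = 1 + PowerSeries.C X * (eulerianSeries - 1) := by
  have h : eulerianSeries - 1 = egf fun j => if j = 0 then 0 else eulerianPoly j := by
    rw [sub_eq_iff_eq_add', ← egf_one, egf_add, eulerianSeries]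
    congr 1
    funext n
    split_ifs with h
    · simp [h, eulerianPoly_zero]
    · simp
  rw [h, weakEulerianSeries, ← egf_one, C_mul_egf, egf_add]
  congr 1
  funext n
  split_ifs <;> simp

theorem one_sub_X_mul_scaledExpSeries :
    PowerSeries.C (1 - X) * scaledExpSeries = expSeries (1 - X) - 1 := by
  rw [eq_sub_iff_add_eq, scaledExpSeries, ← egf_one, C_mul_egf, egf_add, expSeries]
  congr 1
  funext n
  split_ifs with h
  · simp [h]
  · rw [← pow_succ', Nat.sub_add_cancel (Nat.pos_of_ne_zero h), add_zero]

theorem C_one_sub_X_ne_zero : (PowerSeries.C (1 - X : ℝ[X])) ≠ 0 := by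
  intro h
  have h1 : (1 - X : ℝ[X]) = 0 := by
    have := congrArg PowerSeries.constantCoeff h
    simpa using this
  have := congrArg (Polynomial.eval 0) h1
  simp at this

/-- Both expressions for `W` are equated: `D e^{xz} = 1 + x(D e^z - 1)`. -/
theorem derangementSeries_mul :
    derangementSeries * (expSeries X - PowerSeries.C X * expSeries 1) = PowerSeries.C (1 - X) := by
  have h := weakEulerianSeries_eq_add
  rw [weakEulerianSeries_eq, eulerianSeries_eq] at h
  rw [map_sub, map_one]
  linear_combination h

theorem expSeries_one_eq : expSeries (1 : ℝ[X]) = expSeries (1 - X) * expSeries X := by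
  rw [expSeries_mul, sub_add_cancel]

theorem weakEulerianSeries_mul :
    weakEulerianSeries * (1 - PowerSeries.C X * expSeries (1 - X)) = PowerSeries.C (1 - X) := by
  rw [← derangementSeries_mul, weakEulerianSeries_eq, expSeries_one_eq]
  ring

/-- After multiplication by `1 - x`, which is cancellable, `1 - xy` becomes `1 - x e^{(1-x)z}`. -/
theorem weakEulerianSeries_mul_one_sub :
    weakEulerianSeries * (1 - PowerSeries.C X * scaledExpSeries) = 1 := by
  refine mul_left_cancel₀ C_one_sub_X_ne_zero ?_
  have h1 := weakEulerianSeries_mul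
  have h2 := one_sub_X_mul_scaledExpSeries
  rw [map_sub, map_one] at *
  linear_combination h1 - weakEulerianSeries * PowerSeries.C X * h2

theorem eulerianSeries_sub_one :
    eulerianSeries - 1 = scaledExpSeries * weakEulerianSeries := by
  refine mul_left_cancel₀ C_one_sub_X_ne_zero ?_
  have h1 := weakEulerianSeries_mul
  have h2 := one_sub_X_mul_scaledExpSeries
  have h3 : eulerianSeries = expSeries (1 - X) * weakEulerianSeries := by
    rw [eulerianSeries_eq, weakEulerianSeries_eq, expSeries_one_eq]
    ring
  rw [h3]
  rw [map_sub, map_one] at *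
  linear_combination h1 - weakEulerianSeries * h2

theorem derangementSeries_eq :
    derangementSeries = expSeries (-X) * weakEulerianSeries := by
  rw [weakEulerianSeries_eq, mul_left_comm, expSeries_mul, neg_add_cancel, expSeries_zero, mul_one]

theorem X_dvd_scaledExpSeries : PowerSeries.X ∣ scaledExpSeries := by
  rw [PowerSeries.X_dvd_iff, scaledExpSeries, constantCoeff_egf]
  simp

/-! ### Expansions in powers of a power series -/

/-- Pascal's rule, with a boundary term from truncation; it drives the induction on `k` for `∑_j (j
choose k) x^{j-k} y^j = y^k / (1 - xy)^{k+1}`. -/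
theorem one_sub_mul_sum_choose {R : Type*} [CommRing R] (x y : R) (k N : ℕ) :
    (1 - x * y) * ∑ j ∈ Finset.range (N + 1), (j.choose (k + 1) : R) * x ^ (j - (k + 1)) * y ^ j =
      y * (∑ j ∈ Finset.range (N + 1), (j.choose k : R) * x ^ (j - k) * y ^ j) -
        ((N + 1).choose (k + 1) : R) * x ^ (N - k) * y ^ (N + 1) := by
  induction N with
  | zero =>
    rcases Nat.eq_zero_or_pos k with rfl | hk
    · simp
    · simp [Nat.choose_eq_zero_of_lt hk, Nat.choose_eq_zero_of_lt (show 1 < k + 1 by omega)]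
  | succ N ih =>
    rw [Finset.sum_range_succ, mul_add, ih, Finset.sum_range_succ _ (N + 1), mul_add]
    rw [Nat.choose_succ_succ (N + 1) k, Nat.add_sub_add_right]
    rcases lt_or_ge N k with h | h
    · rw [Nat.choose_eq_zero_of_lt (show N + 1 < k + 1 by omega)]
      push_cast
      ring
    · rw [Nat.sub_add_comm h]
      push_cast
      ring

/-- Working modulo a power of the variable replaces infinite sums: the truncation error is a
multiple of `y^{N+1}`. -/
theorem X_pow_dvd_sum_choose_sub {R : Type*} [CommRing R] (x : R) {y W : PowerSeries R}
    (hy : PowerSeries.X ∣ y) (hW : W * (1 - PowerSeries.C x * y) = 1) (k N : ℕ) :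
    PowerSeries.X ^ (N + 1) ∣
      (∑ j ∈ Finset.range (N + 1), (j.choose k : PowerSeries R) * PowerSeries.C x ^ (j - k) * y ^ j)
        - y ^ k * W ^ (k + 1) := by
  have hpow : PowerSeries.X ^ (N + 1) ∣ y ^ (N + 1) := pow_dvd_pow_of_dvd hy _
  induction k with
  | zero =>
    have h := mul_neg_geom_sum (PowerSeries.C x * y) (N + 1)
    simp only [Nat.choose_zero_right, Nat.cast_one, one_mul, Nat.sub_zero, pow_zero, zero_add,
      pow_one, ← mul_pow]
    have h' : (∑ j ∈ Finset.range (N + 1), (PowerSeries.C x * y) ^ j) - W =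
        y ^ (N + 1) * (-(W * PowerSeries.C x ^ (N + 1))) := by
      rw [mul_pow (PowerSeries.C x) y (N + 1)] at h
      linear_combination W * h - (∑ j ∈ Finset.range (N + 1), (PowerSeries.C x * y) ^ j) * hW
    rw [h']
    exact hpow.mul_right _
  | succ k ih =>
    have h := one_sub_mul_sum_choose (PowerSeries.C x) y k N
    set S := ∑ j ∈ Finset.range (N + 1),
      (j.choose k : PowerSeries R) * PowerSeries.C x ^ (j - k) * y ^ j
    set S' := ∑ j ∈ Finset.range (N + 1),
      (j.choose (k + 1) : PowerSeries R) * PowerSeries.C x ^ (j - (k + 1)) * y ^ j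
    have h' : S' - y ^ (k + 1) * W ^ (k + 1 + 1) = (S - y ^ k * W ^ (k + 1)) * (W * y) -
        y ^ (N + 1) * (((N + 1).choose (k + 1) : PowerSeries R) * PowerSeries.C x ^ (N - k) * W) := by
      linear_combination W * h - S' * hW
    rw [h']
    exact dvd_sub (ih.mul_right _) (hpow.mul_right _)

theorem coeff_pow_mul_pow_succ {R : Type*} [CommRing R] (x : R) {y W : PowerSeries R}
    (hy : PowerSeries.X ∣ y) (hW : W * (1 - PowerSeries.C x * y) = 1) (k : ℕ) {n N : ℕ}
    (hn : n ≤ N) :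
    PowerSeries.coeff n (y ^ k * W ^ (k + 1)) =
      ∑ j ∈ Finset.range (N + 1), (j.choose k : R) * x ^ (j - k) * PowerSeries.coeff n (y ^ j) := by
  have h := PowerSeries.X_pow_dvd_iff.1 (X_pow_dvd_sum_choose_sub x hy hW k N) n (by omega)
  rw [map_sub, sub_eq_zero, map_sum] at h
  rw [← h]
  refine Finset.sum_congr rfl fun j _ => ?_
  rw [← map_natCast (PowerSeries.C (R := R)), ← map_pow, ← map_mul, PowerSeries.coeff_C_mul]

theorem coeff_prod_eq_sum_antidiagonalTuple {R : Type*} [CommSemiring R] {k : ℕ}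
    (f : Fin k → PowerSeries R) (n : ℕ) :
    PowerSeries.coeff n (∏ i, f i) =
      ∑ m ∈ Finset.Nat.antidiagonalTuple k n, ∏ i, PowerSeries.coeff (m i) (f i) := by
  rw [PowerSeries.coeff_prod]
  refine Finset.sum_bij (fun l _ => (l : Fin k → ℕ)) ?_ ?_ ?_ ?_
  · intro l hl
    rw [Finset.mem_finsuppAntidiag] at hl
    exact Finset.Nat.mem_antidiagonalTuple.2 hl.1
  · intro l _ l' _ h
    exact DFunLike.coe_injective h
  · intro m hm
    refine ⟨Finsupp.equivFunOnFinite.symm m, ?_, ?_⟩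
    · rw [Finset.mem_finsuppAntidiag]
      exact ⟨by simpa using Finset.Nat.mem_antidiagonalTuple.1 hm, Finset.subset_univ _⟩
    · simp
  · intro l _
    rfl

/-! ### The local `h`-polynomial of the second barycentric subdivision -/

theorem sum_orderedPartitionCount_mul {s m : ℕ} (h : s ≤ m) (f : ℕ → ℝ[X]) :
    ∑ r ∈ Finset.range (m + 1), (orderedPartitionCount s r : ℝ[X]) * f r =
      ∑ r ∈ Finset.range (s + 1), (orderedPartitionCount s r : ℝ[X]) * f r := by
  refine (Finset.sum_subset (Finset.range_mono (by omega)) fun r _ hr => ?_).symm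
  rw [orderedPartitionCount_eq_zero_of_lt (by rw [Finset.mem_range] at hr; omega), Nat.cast_zero,
    zero_mul]

theorem egf_mul_scaledExpSeries (f : ℕ → ℝ[X]) : egf f * scaledExpSeries =
    egf fun n => ∑ k ∈ Finset.range n, (n.choose k : ℝ[X]) * (f k * (1 - X) ^ (n - k - 1)) := by
  rw [scaledExpSeries, egf_mul]
  refine congrArg egf (funext fun n => ?_)
  rw [Finset.sum_range_succ, Nat.sub_self, if_pos rfl, mul_zero, mul_zero, add_zero]
  refine Finset.sum_congr rfl fun k hk => ?_
  rw [if_neg (by have := Finset.mem_range.1 hk; omega)]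

/-- A nonempty block of size `b` has weight `(1-x)^{b-1}`, so `j` blocks covering `r` points have
total weight `(1-x)^{r-j}`. -/
theorem scaledExpSeries_pow (j : ℕ) : scaledExpSeries ^ j =
    egf fun r => (orderedPartitionCount r j : ℝ[X]) * (1 - X) ^ (r - j) := by
  induction j with
  | zero =>
    rw [pow_zero, ← egf_one]
    refine congrArg egf (funext fun r => ?_)
    rw [orderedPartitionCount_zero_right]
    split_ifs with h <;> simp [h]
  | succ j ih =>
    rw [pow_succ, ih, egf_mul_scaledExpSeries]
    refine congrArg egf (funext fun r => ?_)
    rw [orderedPartitionCount_succ, Nat.cast_sum, Finset.sum_mul]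
    refine Finset.sum_congr rfl fun k hk => ?_
    rw [Finset.mem_range] at hk
    -- For `k < j` the truncated exponents do not add up, but the count is zero.
    rcases lt_or_ge k j with h | h
    · rw [orderedPartitionCount_eq_zero_of_lt h]
      simp
    · rw [show r - (j + 1) = (k - j) + (r - k - 1) by omega, pow_add]
      push_cast
      ring

/-- The polynomial `∑_i t(r, i) x^i (1 - x)^(r - i)`, where `t(r, i)` is the number of ordered
partitions of an `r`-set into `i` blocks. -/
noncomputable def orderedPartitionPoly (r : ℕ) : ℝ[X] :=
  ∑ i ∈ Finset.range (r + 1), (orderedPartitionCount r i : ℝ[X]) * (X ^ i * (1 - X) ^ (r - i))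

theorem orderedPartitionPoly_eq (n : ℕ) : orderedPartitionPoly n = (if n = 0 then 1 else 0) +
    X * ∑ k ∈ Finset.range n,
      (n.choose k : ℝ[X]) * (orderedPartitionPoly k * (1 - X) ^ (n - k - 1)) := by
  rw [orderedPartitionPoly, Finset.sum_range_succ', add_comm]
  congr 1
  · rw [orderedPartitionCount_zero_right]
    split_ifs with h <;> simp [h]
  · have h : ∀ k ∈ Finset.range n,
        (n.choose k : ℝ[X]) * (orderedPartitionPoly k * (1 - X) ^ (n - k - 1)) =
          ∑ i ∈ Finset.range n, (n.choose k : ℝ[X]) *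
            ((orderedPartitionCount k i : ℝ[X]) * (X ^ i * (1 - X) ^ (n - 1 - i))) := by
      intro k hk
      rw [Finset.mem_range] at hk
      have h1 := sum_orderedPartitionCount_mul (show k ≤ n - 1 by omega)
        fun i => X ^ i * (1 - X) ^ (n - 1 - i)
      rw [Nat.sub_add_cancel (by omega)] at h1
      rw [← Finset.mul_sum, h1, orderedPartitionPoly, Finset.sum_mul]
      congr 1
      refine Finset.sum_congr rfl fun i hi => ?_
      rw [Finset.mem_range] at hi
      rw [show n - 1 - i = (k - i) + (n - k - 1) by omega, pow_add]
      ring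
    rw [Finset.sum_congr rfl h, Finset.sum_comm, Finset.mul_sum]
    refine Finset.sum_congr rfl fun i _ => ?_
    rw [orderedPartitionCount_succ, Nat.cast_sum, Finset.sum_mul, Finset.mul_sum]
    refine Finset.sum_congr rfl fun k _ => ?_
    rw [show n - (i + 1) = n - 1 - i by omega]
    push_cast
    ring

/-- Splitting off one block gives `E = 1 + xyE`, which `W` solves uniquely. -/
theorem egf_orderedPartitionPoly : egf orderedPartitionPoly = weakEulerianSeries := by
  have h : egf orderedPartitionPoly =
      1 + PowerSeries.C X * (egf orderedPartitionPoly * scaledExpSeries) := by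
    rw [egf_mul_scaledExpSeries, C_mul_egf, ← egf_one, egf_add]
    exact congrArg egf (funext orderedPartitionPoly_eq)
  linear_combination weakEulerianSeries * h -
    egf orderedPartitionPoly * weakEulerianSeries_mul_one_sub

theorem orderedPartitionPoly_eq_sum_derangementPoly (r : ℕ) : orderedPartitionPoly r =
    ∑ k ∈ Finset.range (r + 1), (r.choose k : ℝ[X]) * (derangementPoly k * X ^ (r - k)) := by
  have h := egf_orderedPartitionPoly
  rw [weakEulerianSeries_eq, derangementSeries, expSeries, egf_mul] at h
  exact congrFun (egf_injective h) r

/-- The binomial transform of the `h`-polynomials of the second barycentric subdivisions of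
simplices. -/
noncomputable def sdSdTransform (s : ℕ) : ℝ[X] :=
  ∑ r ∈ Finset.range (s + 1),
    (orderedPartitionCount s r : ℝ[X]) * ((1 - X) ^ (s - r) * orderedPartitionPoly r)

theorem sdSdH_eq (m : ℕ) : sdSdH m =
    ∑ s ∈ Finset.range (m + 1), (m.choose s : ℝ[X]) * (sdSdTransform s * (1 - X) ^ (m - s)) := by
  have h : ∀ s ∈ Finset.range (m + 1),
      (m.choose s : ℝ[X]) * (sdSdTransform s * (1 - X) ^ (m - s)) =
        ∑ r ∈ Finset.range (m + 1), ∑ i ∈ Finset.range (m + 1), (m.choose s : ℝ[X]) *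
          ((orderedPartitionCount s r : ℝ[X]) *
            ((orderedPartitionCount r i : ℝ[X]) * (X ^ i * (1 - X) ^ (m - i)))) := by
    intro s hs
    rw [Finset.mem_range] at hs
    simp_rw [← Finset.mul_sum]
    rw [sum_orderedPartitionCount_mul (by omega : s ≤ m), sdSdTransform, Finset.sum_mul]
    congr 1
    refine Finset.sum_congr rfl fun r hr => ?_
    rw [Finset.mem_range] at hr
    rw [sum_orderedPartitionCount_mul (by omega : r ≤ m), orderedPartitionPoly, mul_assoc,
      mul_right_comm, Finset.mul_sum]
    congr 1
    refine Finset.sum_congr rfl fun i hi => ?_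
    rw [Finset.mem_range] at hi
    -- The weight factors along `i ≤ r ≤ s ≤ m`, one factor for each counting step.
    rw [show m - i = (s - r) + (m - s) + (r - i) by omega, pow_add, pow_add]
    ring
  rw [Finset.sum_congr rfl h, Finset.sum_comm, sdSdH]
  rw [Finset.sum_congr rfl fun r _ => Finset.sum_comm, Finset.sum_comm]
  refine Finset.sum_congr rfl fun i _ => ?_
  rw [sdSdFaceCount, Nat.cast_sum, Finset.sum_mul, Finset.sum_mul]
  refine Finset.sum_congr rfl fun r _ => ?_
  rw [sdFaceCount, Nat.cast_mul, Nat.cast_sum, Finset.sum_mul, Finset.sum_mul, Finset.sum_mul]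
  refine Finset.sum_congr rfl fun s _ => ?_
  push_cast
  ring

theorem coeff_egf_sdSdTransform (n : ℕ) : PowerSeries.coeff n (egf sdSdTransform) =
    ∑ r ∈ Finset.range (n + 1),
      orderedPartitionPoly r * PowerSeries.coeff n (scaledExpSeries ^ r) := by
  rw [coeff_egf, sdSdTransform, Finset.mul_sum]
  refine Finset.sum_congr rfl fun r _ => ?_
  rw [scaledExpSeries_pow, coeff_egf]
  ring

/-- Expanding `P_r` in the `d_k` and exchanging sums makes the sum over `r` equal to `y^k W^{k+1} =
W (yW)^k`. The free bound `N` lets one truncation serve all coefficients of a product. -/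
theorem coeff_egf_sdSdTransform_eq_coeff_mul {n N : ℕ} (h : n ≤ N) :
    PowerSeries.coeff n (egf sdSdTransform) =
      PowerSeries.coeff n (weakEulerianSeries * ∑ k ∈ Finset.range (N + 1),
        PowerSeries.C (derangementPoly k) * (scaledExpSeries * weakEulerianSeries) ^ k) := by
  have hpow : ∀ r, n < r → PowerSeries.coeff n (scaledExpSeries ^ r) = 0 := fun r hr =>
    PowerSeries.X_pow_dvd_iff.1 (pow_dvd_pow_of_dvd X_dvd_scaledExpSeries r) n hr
  have hN : PowerSeries.coeff n (egf sdSdTransform) = ∑ r ∈ Finset.range (N + 1),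
      orderedPartitionPoly r * PowerSeries.coeff n (scaledExpSeries ^ r) := by
    rw [coeff_egf_sdSdTransform]
    refine Finset.sum_subset (Finset.range_mono (by omega)) fun r _ hr => ?_
    rw [hpow r (by rw [Finset.mem_range] at hr; omega), mul_zero]
  have hterm : ∀ k, PowerSeries.coeff n (weakEulerianSeries *
      (PowerSeries.C (derangementPoly k) * (scaledExpSeries * weakEulerianSeries) ^ k)) =
      ∑ r ∈ Finset.range (N + 1), derangementPoly k *
        ((r.choose k : ℝ[X]) * X ^ (r - k) * PowerSeries.coeff n (scaledExpSeries ^ r)) := by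
    intro k
    rw [← Finset.mul_sum, ← coeff_pow_mul_pow_succ X X_dvd_scaledExpSeries
      weakEulerianSeries_mul_one_sub k h, ← PowerSeries.coeff_C_mul]
    refine congrArg (PowerSeries.coeff n) ?_
    ring
  rw [hN, Finset.mul_sum, map_sum, Finset.sum_congr rfl fun k _ => hterm k, Finset.sum_comm]
  refine Finset.sum_congr rfl fun r hr => ?_
  rw [Finset.mem_range] at hr
  rw [orderedPartitionPoly_eq_sum_derangementPoly, Finset.sum_mul]
  refine Finset.sum_subset_zero_on_sdiff (Finset.range_mono (by omega)) (fun k hk => ?_)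
    fun k _ => by ring
  rw [Finset.mem_sdiff, Finset.mem_range, Finset.mem_range] at hk
  rw [Nat.choose_eq_zero_of_lt (by omega)]
  simp

/-- The local `h`-polynomial of the second barycentric subdivision of the simplex with `n`
vertices. -/
noncomputable def sdSdLocalH (n : ℕ) : ℝ[X] :=
  ∑ m ∈ Finset.range (n + 1), (n.choose m : ℝ[X]) * (sdSdH m * (-1) ^ (n - m))

theorem egf_sdSdLocalH : egf sdSdLocalH = expSeries (-X) * egf sdSdTransform := by
  have h1 : egf sdSdLocalH = egf sdSdH * expSeries (-1) := by
    rw [expSeries, egf_mul]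
    rfl
  have h2 : egf sdSdH = egf sdSdTransform * expSeries (1 - X) := by
    rw [expSeries, egf_mul]
    exact congrArg egf (funext sdSdH_eq)
  rw [h1, h2, mul_assoc, expSeries_mul, mul_comm]
  congr 2
  ring

theorem coeff_egf_sdSdLocalH (n : ℕ) : PowerSeries.coeff n (egf sdSdLocalH) =
    PowerSeries.coeff n (derangementSeries * ∑ k ∈ Finset.range (n + 1),
      PowerSeries.C (derangementPoly k) * (eulerianSeries - 1) ^ k) := by
  rw [egf_sdSdLocalH, derangementSeries_eq, mul_assoc, PowerSeries.coeff_mul,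
    PowerSeries.coeff_mul, eulerianSeries_sub_one]
  refine Finset.sum_congr rfl fun p hp => ?_
  rw [coeff_egf_sdSdTransform_eq_coeff_mul (N := n) (by have := Finset.HasAntidiagonal.mem_antidiagonal.1 hp; omega)]

theorem coeff_eulerianSeries_sub_one (j : ℕ) : PowerSeries.coeff j (eulerianSeries - 1) =
    algebraMap ℚ ℝ[X] (1 / j.factorial) * (if 1 ≤ j then eulerianPoly j else 0) := by
  rw [map_sub, eulerianSeries, coeff_egf, PowerSeries.coeff_one]
  rcases Nat.eq_zero_or_pos j with rfl | hj
  · simp [eulerianPoly_zero]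
  · rw [if_neg hj.ne', if_pos (Nat.succ_le_iff.2 hj), sub_zero]

theorem coeff_derangementSeries_mul_pow (k n : ℕ) :
    PowerSeries.coeff n (derangementSeries * (eulerianSeries - 1) ^ k) =
      algebraMap ℚ ℝ[X] (1 / n.factorial) *
        ∑ m ∈ (Finset.Nat.antidiagonalTuple (k + 1) n).filter (fun m => ∀ i : Fin k, 1 ≤ m i.succ),
          (Nat.multinomial Finset.univ m : ℝ[X]) * derangementPoly (m 0) *
            ∏ i : Fin k, eulerianPoly (m i.succ) := by
  have h : derangementSeries * (eulerianSeries - 1) ^ k =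
      ∏ i : Fin (k + 1), (Fin.cons derangementSeries fun _ => eulerianSeries - 1 :
        Fin (k + 1) → PowerSeries ℝ[X]) i := by
    simp [Fin.prod_univ_succ]
  rw [h, coeff_prod_eq_sum_antidiagonalTuple, Finset.mul_sum, Finset.sum_filter]
  refine Finset.sum_congr rfl fun m hm => ?_
  rw [Fin.prod_univ_succ]
  simp only [Fin.cons_zero, Fin.cons_succ, coeff_eulerianSeries_sub_one]
  split_ifs with hpos
  · have hmul : (1 / n.factorial : ℚ) * Nat.multinomial Finset.univ m =
        ∏ i, (1 / (m i).factorial : ℚ) := by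
      have h1 := Nat.multinomial_spec Finset.univ m
      rw [Finset.Nat.mem_antidiagonalTuple.1 hm] at h1
      have h2 : (∏ i, ((m i).factorial : ℚ)) * Nat.multinomial Finset.univ m = n.factorial := by
        exact_mod_cast h1
      have h3 : (n.factorial : ℚ) ≠ 0 := by exact_mod_cast n.factorial_ne_zero
      have h4 : (∏ i, ((m i).factorial : ℚ)) ≠ 0 := fun h => h3 (by rw [← h2, h, zero_mul])
      rw [Finset.prod_div_distrib, Finset.prod_const_one, eq_div_iff h4, ← h2]
      rw [← h2] at h3
      field_simp
      exact (div_self (right_ne_zero_of_mul h3))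
    rw [derangementSeries, coeff_egf, ← mul_assoc, ← mul_assoc,
      ← map_natCast (algebraMap ℚ ℝ[X]) (Nat.multinomial _ _), ← map_mul, hmul,
      Fin.prod_univ_succ, map_mul, map_prod,
      Finset.prod_congr rfl fun i _ => by rw [if_pos (hpos i)], Finset.prod_mul_distrib]
    ring
  -- `A - 1` has no constant term, so a tuple with a zero entry after the first contributes nothing.
  · push Not at hpos
    obtain ⟨i, hi⟩ := hpos
    rw [Finset.prod_eq_zero (Finset.mem_univ i), mul_zero]
    rw [if_neg (by omega), mul_zero]

theorem sdSdLocalH_eq (n : ℕ) : sdSdLocalH n =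
    ∑ k ∈ Finset.range (n + 1),
      ∑ m ∈ (Finset.Nat.antidiagonalTuple (k + 1) n).filter (fun m => ∀ i : Fin k, 1 ≤ m i.succ),
        (Nat.multinomial Finset.univ m : ℝ[X]) * derangementPoly k * derangementPoly (m 0) *
          ∏ i : Fin k, eulerianPoly (m i.succ) := by
  have h := coeff_egf_sdSdLocalH n
  rw [Finset.mul_sum, map_sum, coeff_egf] at h
  simp_rw [mul_left_comm derangementSeries, PowerSeries.coeff_C_mul,
    coeff_derangementSeries_mul_pow, mul_left_comm _ (algebraMap ℚ ℝ[X] _)] at h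
  rw [← Finset.mul_sum] at h
  have h' := congrArg (fun p => (n.factorial : ℝ[X]) * p) h
  simp only [← mul_assoc] at h'
  rw [mul_comm (n.factorial : ℝ[X]), algebraMap_inv_factorial_mul, one_mul, one_mul] at h'
  rw [h']
  refine Finset.sum_congr rfl fun k _ => ?_
  rw [Finset.mul_sum]
  refine Finset.sum_congr rfl fun m _ => ?_
  ring

theorem CarriedComplex.localH_simplex_sd_sd_eq {V : Type*} [Fintype V] [DecidableEq V] :
    (CarriedComplex.simplex V).sd.sd.localH = sdSdLocalH (Fintype.card V) := by
  rw [localH_simplex_sd_sd, sdSdLocalH]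
  simp_rw [mul_comm (sdSdH _)]

/-! ### Gamma-positivity -/

namespace IsGammaPositive

theorem C_mul_X_pow_mul {n i : ℕ} (h : 2 * i ≤ n) {c : ℝ} (hc : 0 ≤ c) :
    IsGammaPositive n (C c * X ^ i * (1 + X) ^ (n - 2 * i)) := by
  refine ⟨Pi.single i c, fun j => ?_, ?_⟩
  · exact (Pi.single_nonneg (α := fun _ : ℕ => ℝ)).2 hc j
  · rw [Finset.sum_eq_single_of_mem i (Finset.mem_range.2 (by omega)), Pi.single_eq_same]
    intro j _ hj
    rw [Pi.single_eq_of_ne hj]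
    simp

theorem zero (n : ℕ) : IsGammaPositive n 0 := ⟨0, fun _ => le_rfl, by simp⟩

theorem add {n : ℕ} {f g : ℝ[X]} (hf : IsGammaPositive n f) (hg : IsGammaPositive n g) :
    IsGammaPositive n (f + g) := by
  obtain ⟨γ, hγ, rfl⟩ := hf
  obtain ⟨δ, hδ, rfl⟩ := hg
  refine ⟨γ + δ, fun i => add_nonneg (hγ i) (hδ i), ?_⟩
  rw [← Finset.sum_add_distrib]
  refine Finset.sum_congr rfl fun i _ => ?_
  rw [Pi.add_apply, C_add]
  ring

theorem sum {α : Type*} {n : ℕ} {s : Finset α} {f : α → ℝ[X]}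
    (h : ∀ a ∈ s, IsGammaPositive n (f a)) : IsGammaPositive n (∑ a ∈ s, f a) :=
  Finset.sum_induction f (IsGammaPositive n) (fun _ _ => add) (zero n) h

theorem mul {m n : ℕ} {f g : ℝ[X]} (hf : IsGammaPositive m f) (hg : IsGammaPositive n g) :
    IsGammaPositive (m + n) (f * g) := by
  obtain ⟨γ, hγ, rfl⟩ := hf
  obtain ⟨δ, hδ, rfl⟩ := hg
  rw [Finset.sum_mul_sum]
  refine sum fun i hi => sum fun j hj => ?_
  rw [Finset.mem_range] at hi hj
  have h := C_mul_X_pow_mul (show 2 * (i + j) ≤ m + n by omega) (mul_nonneg (hγ i) (hδ j))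
  rw [show m + n - 2 * (i + j) = (m - 2 * i) + (n - 2 * j) by omega, C_mul, pow_add, pow_add] at h
  convert h using 1
  ring

theorem natCast (c : ℕ) : IsGammaPositive 0 (c : ℝ[X]) := by
  simpa using C_mul_X_pow_mul (le_refl (2 * 0)) (Nat.cast_nonneg (α := ℝ) c)

theorem one : IsGammaPositive 0 1 := by simpa using natCast 1

theorem natCast_mul {n : ℕ} {f : ℝ[X]} (c : ℕ) (hf : IsGammaPositive n f) :
    IsGammaPositive n ((c : ℝ[X]) * f) := by
  simpa using (natCast c).mul hf

theorem X : IsGammaPositive 2 X := by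
  simpa using C_mul_X_pow_mul (show 2 * 1 ≤ 2 by norm_num) zero_le_one

theorem one_add_X : IsGammaPositive 1 (1 + Polynomial.X) := by
  simpa using C_mul_X_pow_mul (show 2 * 0 ≤ 1 by norm_num) zero_le_one

theorem prod {α : Type*} {s : Finset α} {c : α → ℕ} {f : α → ℝ[X]}
    (h : ∀ a ∈ s, IsGammaPositive (c a) (f a)) :
    IsGammaPositive (∑ a ∈ s, c a) (∏ a ∈ s, f a) := by
  classical
  induction s using Finset.induction_on with
  | empty => simpa using one
  | insert a s ha ih =>
    rw [Finset.sum_insert ha, Finset.prod_insert ha]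
    exact (h a (Finset.mem_insert_self a s)).mul
      (ih fun b hb => h b (Finset.mem_insert_of_mem hb))

end IsGammaPositive

/-! ### Differential equations and the resulting recurrences -/

theorem eulerianSeries_sub_one_eq_egf :
    eulerianSeries - 1 = egf fun j => if 1 ≤ j then eulerianPoly j else 0 := by
  ext1 j
  rw [coeff_eulerianSeries_sub_one, coeff_egf]

theorem derivative_derangementSeries : PowerSeries.derivative ℝ[X] derangementSeries =
    PowerSeries.C X * ((eulerianSeries - 1) * derangementSeries) := by
  have h := derangementSeries_mul
  have hne : expSeries X - PowerSeries.C X * expSeries (1 : ℝ[X]) ≠ 0 := by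
    intro h0
    rw [h0, mul_zero] at h
    exact C_one_sub_X_ne_zero h.symm
  have hder := congrArg (PowerSeries.derivative ℝ[X]) h
  rw [derivative_mul_eq, derivative_sub_eq, derivative_mul_eq, derivative_expSeries,
    derivative_expSeries, PowerSeries.derivative_C, PowerSeries.derivative_C, map_one] at hder
  refine mul_right_cancel₀ hne ?_
  rw [eulerianSeries_eq]
  rw [map_sub, map_one] at h
  linear_combination hder - PowerSeries.C X * derangementSeries * expSeries 1 * h

/-- From `A = D e^z`, `A' = A + x(A-1)A`. Expanding in `A - 1` leaves only Eulerian polynomials of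
positive index, as the centers of symmetry require. -/
theorem derivative_eulerianSeries : PowerSeries.derivative ℝ[X] eulerianSeries =
    1 + PowerSeries.C (1 + X) * (eulerianSeries - 1) +
      PowerSeries.C X * ((eulerianSeries - 1) * (eulerianSeries - 1)) := by
  have h : PowerSeries.derivative ℝ[X] eulerianSeries =
      derangementSeries * expSeries 1 +
        PowerSeries.derivative ℝ[X] derangementSeries * expSeries 1 := by
    rw [eulerianSeries_eq, derivative_mul_eq, derivative_expSeries, map_one, one_mul]
  rw [h, derivative_derangementSeries, map_add, map_one]
  linear_combination (-1 - PowerSeries.C X * (eulerianSeries - 1)) * eulerianSeries_eq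

theorem derangementPoly_succ (n : ℕ) : derangementPoly (n + 1) =
    X * ∑ k ∈ Finset.range (n + 1), (n.choose k : ℝ[X]) *
      ((if 1 ≤ k then eulerianPoly k else 0) * derangementPoly (n - k)) := by
  have h := derivative_derangementSeries
  rw [eulerianSeries_sub_one_eq_egf, derangementSeries, derivative_egf, egf_mul, C_mul_egf] at h
  exact congrFun (egf_injective h) n

theorem eulerianPoly_succ {n : ℕ} (hn : 1 ≤ n) : eulerianPoly (n + 1) =
    (1 + X) * eulerianPoly n + X * ∑ k ∈ Finset.range (n + 1), (n.choose k : ℝ[X]) *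
      ((if 1 ≤ k then eulerianPoly k else 0) *
        (if 1 ≤ n - k then eulerianPoly (n - k) else 0)) := by
  have h := derivative_eulerianSeries
  rw [eulerianSeries_sub_one_eq_egf, eulerianSeries, derivative_egf, egf_mul, C_mul_egf, C_mul_egf,
    ← egf_one, egf_add, egf_add] at h
  have h' := congrFun (egf_injective h) n
  rw [h', if_neg (by omega), if_pos hn, zero_add]

/-- In the recurrence, `(1+x)A_n` has twice-center `1 + (n-1)` and `x A_k A_{n-k}` has `2 + (k-1) +
(n-k-1)`; both equal `n`. -/
theorem isGammaPositive_eulerianPoly (n : ℕ) : IsGammaPositive n (eulerianPoly (n + 1)) := by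
  induction n using Nat.strong_induction_on with
  | _ n ih =>
    have ih' : ∀ j, 1 ≤ j → j ≤ n → IsGammaPositive (j - 1) (eulerianPoly j) := fun j h1 h2 => by
      have := ih (j - 1) (by omega)
      rwa [Nat.sub_add_cancel h1] at this
    rcases Nat.eq_zero_or_pos n with rfl | hn
    · simpa [eulerianPoly, excedances] using IsGammaPositive.one
    · rw [eulerianPoly_succ hn]
      refine IsGammaPositive.add ?_ ?_
      · have := IsGammaPositive.one_add_X.mul (ih' n hn le_rfl)
        rwa [Nat.add_sub_cancel' hn] at this
      · rw [Finset.mul_sum]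
        refine IsGammaPositive.sum fun k hk => ?_
        rw [Finset.mem_range] at hk
        by_cases h : 1 ≤ k ∧ 1 ≤ n - k
        · have := IsGammaPositive.X.mul (((ih' k h.1 (by omega)).mul
            (ih' (n - k) h.2 (by omega))).natCast_mul (n.choose k))
          rw [if_pos h.1, if_pos h.2]
          rwa [show 2 + (k - 1 + (n - k - 1)) = n by omega] at this
        · convert IsGammaPositive.zero n
          rw [not_and_or] at h
          rcases h with h | h <;> rw [if_neg h] <;> simp

theorem isGammaPositive_derangementPoly (n : ℕ) : IsGammaPositive n (derangementPoly n) := by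
  induction n using Nat.strong_induction_on with
  | _ n ih =>
    rcases n with _ | n
    · rw [derangementPoly_zero]
      exact IsGammaPositive.one
    · rw [derangementPoly_succ, Finset.mul_sum]
      refine IsGammaPositive.sum fun k hk => ?_
      rw [Finset.mem_range] at hk
      split_ifs with h
      · have hA := isGammaPositive_eulerianPoly (k - 1)
        rw [Nat.sub_add_cancel h] at hA
        have := IsGammaPositive.X.mul ((hA.mul (ih (n - k) (by omega))).natCast_mul (n.choose k))
        rwa [show 2 + (k - 1 + (n - k)) = n + 1 by omega] at this
      · simpa using IsGammaPositive.zero (n + 1)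

/-- Each of the `k` Eulerian factors falls one short of its index, and `d_k` makes up exactly this
deficit of `k`. -/
theorem isGammaPositive_sdSdLocalH (n : ℕ) : IsGammaPositive n (sdSdLocalH n) := by
  rw [sdSdLocalH_eq]
  refine IsGammaPositive.sum fun k _ => IsGammaPositive.sum fun m hm => ?_
  rw [Finset.mem_filter, Finset.Nat.mem_antidiagonalTuple, Fin.sum_univ_succ] at hm
  obtain ⟨hsum, hpos⟩ := hm
  have hA : IsGammaPositive (∑ i : Fin k, (m i.succ - 1)) (∏ i : Fin k, eulerianPoly (m i.succ)) :=
    IsGammaPositive.prod fun i _ => by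
      have := isGammaPositive_eulerianPoly (m i.succ - 1)
      rwa [Nat.sub_add_cancel (hpos i)] at this
  have hcard : ∑ i : Fin k, (m i.succ - 1) + k = ∑ i : Fin k, m i.succ := by
    have h1 : ∑ i : Fin k, (m i.succ - 1 + 1) = ∑ i : Fin k, m i.succ :=
      Finset.sum_congr rfl fun i _ => Nat.sub_add_cancel (hpos i)
    rw [Finset.sum_add_distrib] at h1
    simpa using h1
  have h := (((isGammaPositive_derangementPoly k).natCast_mul (Nat.multinomial Finset.univ m)).mul
    (isGammaPositive_derangementPoly (m 0))).mul hA
  rwa [show k + m 0 + ∑ i : Fin k, (m i.succ - 1) = n by omega] at h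

/-! ### The sum of the coefficients -/

/-- At `x = 1` only the facet term survives. -/
theorem eval_one_sdSdH (m : ℕ) : (sdSdH m).eval 1 = (m.factorial : ℝ) ^ 2 := by
  rw [sdSdH, eval_finsetSum, Finset.sum_range_succ, Finset.sum_eq_zero]
  · simp [sdSdFaceCount_self]
  · intro i hi
    have : m - i ≠ 0 := by have := Finset.mem_range.1 hi; omega
    simp [this]

theorem card_perm_fixing {n : ℕ} (t : Finset (Fin n)) :
    (Finset.univ.filter fun w : Equiv.Perm (Fin n) => ∀ i ∈ t, w i = i).card =
      (n - t.card).factorial := by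
  rw [← Fintype.card_subtype]
  have h := Fintype.card_congr (Equiv.Perm.subtypeEquivSubtypePerm fun i : Fin n => i ∉ t)
  rw [Fintype.card_perm, Fintype.card_subtype_compl, Fintype.card_fin, Fintype.card_coe] at h
  rw [h]
  exact Fintype.card_congr (Equiv.subtypeEquivRight fun w => by simp)

/-- Inclusion–exclusion over the set `t` of prescribed common fixed points; here `m = n - |t|`. -/
theorem card_pairs_without_common_fixedPoint (n : ℕ) :
    (Fintype.card {p : Equiv.Perm (Fin n) × Equiv.Perm (Fin n) //
        ∀ i, ¬ (p.1 i = i ∧ p.2 i = i)} : ℤ) =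
      ∑ m ∈ Finset.range (n + 1), (n.choose m : ℤ) * ((m.factorial : ℤ) ^ 2 * (-1) ^ (n - m)) := by
  have h := Finset.inclusion_exclusion_card_inf_compl (Finset.univ : Finset (Fin n))
    fun i => Finset.univ.filter
      fun p : Equiv.Perm (Fin n) × Equiv.Perm (Fin n) => p.1 i = i ∧ p.2 i = i
  have hl : (Finset.univ : Finset (Fin n)).inf (fun i => (Finset.univ.filter
      fun p : Equiv.Perm (Fin n) × Equiv.Perm (Fin n) => p.1 i = i ∧ p.2 i = i)ᶜ) =
      Finset.univ.filter fun p => ∀ i, ¬ (p.1 i = i ∧ p.2 i = i) := by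
    ext p
    simp [Finset.mem_inf]
  have hr : ∀ t : Finset (Fin n), (t.inf fun i => Finset.univ.filter
      fun p : Equiv.Perm (Fin n) × Equiv.Perm (Fin n) => p.1 i = i ∧ p.2 i = i).card =
      (n - t.card).factorial ^ 2 := by
    intro t
    rw [← card_perm_fixing, sq, ← Finset.card_product]
    congr 1
    ext p
    simp [Finset.mem_inf, forall_and]
  rw [hl] at h
  rw [Fintype.card_subtype, h]
  simp_rw [hr]
  rw [Finset.sum_powerset_apply_card (fun k => (-1 : ℤ) ^ k * ((n - k).factorial ^ 2 : ℕ)),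
    Finset.card_univ, Fintype.card_fin, ← Finset.sum_range_reflect]
  refine Finset.sum_congr rfl fun m hm => ?_
  have hm' : m ≤ n := Nat.lt_succ_iff.1 (Finset.mem_range.1 hm)
  rw [Nat.add_sub_cancel, Nat.choose_symm hm', Nat.sub_sub_self hm', nsmul_eq_mul]
  push_cast
  ring

theorem eval_one_sdSdLocalH (n : ℕ) : (sdSdLocalH n).eval 1 =
    (Fintype.card {p : Equiv.Perm (Fin n) × Equiv.Perm (Fin n) //
      ∀ i, ¬ (p.1 i = i ∧ p.2 i = i)} : ℝ) := by
  have h := congrArg (Int.cast : ℤ → ℝ) (card_pairs_without_common_fixedPoint n)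
  rw [Int.cast_natCast] at h
  rw [h, sdSdLocalH, eval_finsetSum]
  push_cast
  simp [eval_one_sdSdH]

theorem mainTheorem6 {V : Type*} [Fintype V] [DecidableEq V] (n : ℕ) (hn : Fintype.card V = n) :
    -- the formula; the condition `k ≤ n` is implied by `n₁, …, n_k ≥ 1` and `n₀ + ⋯ + n_k = n`
    (CarriedComplex.simplex V).sd.sd.localH =
        ∑ k ∈ Finset.range (n + 1),
          ∑ m ∈ (Finset.Nat.antidiagonalTuple (k + 1) n).filter (fun m => ∀ i : Fin k, 1 ≤ m i.succ),
            (Nat.multinomial Finset.univ m : ℝ[X]) * derangementPoly k * derangementPoly (m 0) *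
              ∏ i : Fin k, eulerianPoly (m i.succ) ∧
    IsGammaPositive n (CarriedComplex.simplex V).sd.sd.localH ∧
    -- the sum of the coefficients
    ∑ i ∈ (CarriedComplex.simplex V).sd.sd.localH.support,
        (CarriedComplex.simplex V).sd.sd.localH.coeff i =
      (Fintype.card {p : Equiv.Perm (Fin n) × Equiv.Perm (Fin n) //
        ∀ i, ¬ (p.1 i = i ∧ p.2 i = i)} : ℝ) := by
  subst hn
  rw [CarriedComplex.localH_simplex_sd_sd_eq]
  refine ⟨sdSdLocalH_eq _, isGammaPositive_sdSdLocalH _, ?_⟩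
  rw [← eval_one_sdSdLocalH, eval_eq_sum, sum_def]
  simp
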